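/- Fix an integer $K\ge 1$, a constant $C>0$ and a link function $f:\mathbb R\to\mathbb R$. For all $N,J\ge 1$ let $\boldsymbol\theta_i^*\in\mathbb R^K$ ($i\le N$), $\mathbf a_j^*\in\mathbb R^K$ and $d_j^*\in\mathbb R$ ($j\le J$) be the true parameters (they may depend on $(N,J)$), let $\Theta^*$ ($N\times K$) and $A^*$ ($J\times K$) be the matrices with rows $\boldsymbol\theta_i^{*\top}$ and $\mathbf a_j^{*\top}$, and let $Y_{ij}\in\{0,1\}$ be independent with $P(Y_{ij}=1)=f(d_j^*+\mathbf a_j^{*\top}\boldsymbol\theta_i^*)$. The constrained joint maximum likelihood estimator $(\hat\Theta,\hat A,\hat{\mathbf d})$ is any maximizer of the log-likelihood $$\log\prod_{i=1}^N\prod_{j=1}^J f(d_j+\mathbf a_j^\top\boldsymbol\theta_i)^{Y_{ij}}\bigl(1-f(d_j+\mathbf a_j^\top\boldsymbol\theta_i)\bigr)^{1-Y_{ij}}$$ subject to $\sqrt{1+\|\boldsymbol\theta_i\|^2}\le C$ and $\sqrt{d_j^2+\|\mathbf a_j\|^2}\le C$ for all $i,j$. Call an $N\times K$ matrix $\Theta$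 standardized if each of its columns has entries summing to $0$ and $\frac1N\Theta^\top\Theta=I_K$. A standardized version of $(\hat\Theta,\hat A,\hat{\mathbf d})$ is any $(\tilde\Theta,\tilde A,\tilde{\mathbf d})$ with $\tilde\Theta\tilde A^\top+\mathbf 1_N\tilde{\mathbf d}^\top=\hat\Theta\hat A^\top+\mathbf 1_N\hat{\mathbf d}^\top$ and $\tilde\Theta$ standardized; it exists whenever $N>K$. Theorem. Suppose that (A1) for all sufficiently large $N,J$: $\sqrt{1+\|\boldsymbol\theta_i^*\|^2}\le C$ and $\sqrt{(d_j^*)^2+\|\mathbf a_j^*\|^2}\le C$ for all $i\le N$, $j\le J$; (A2) $f$ is differentiable, $0<f(x)<1$ and $f'(x)\neq0$ for $|x|\le C^2$, and $\displaystyle\sup_{|x|\le C^2}\frac{|f'(x)|}{f(x)(1-f(x))}<\infty$, $\displaystyle\sup_{|x|\le C^2}\frac{f(x)(1-f(x))}{f'(x)^2}<\infty$; (A3) for all sufficiently large $N,J$, $\Theta^*$ is standardized; (A4) there is a constant $C_3>0$, not depending on $N$ and $J$, such that for all sufficiently large $N,J$ the $K$-th (smallest) singular value of $A^*$ satisfies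 $\sigma_K(A^*)\ge C_3\sqrt J$. Then the loss $$\min_{Q\in\mathbb R^{K\times K},\;Q^\top Q=I_K}\ \frac1{JK}\,\bigl\|A^*-\tilde AQ\bigr\|_F^2$$ converges to zero in probability as $N,J\to\infty$. -/

import Mathlib

open MeasureTheory ProbabilityTheory Filter Topology

noncomputable section

/-- Parameters of a `K`-factor model for `N` respondents and `J` items: the person parameters
`Θ` (row `i` is `θ_i`), the loadings `A` (row `j` is `a_j`) and the intercepts `d`. -/
structure FactorParams (N J K : ℕ) where
  Θ : Matrix (Fin N) (Fin K) ℝ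
  A : Matrix (Fin J) (Fin K) ℝ
  d : Fin J → ℝ

namespace FactorParams

variable {N J K : ℕ}

/-- The linear predictor `d_j + a_jᵀ θ_i`. -/
def predictor (p : FactorParams N J K) (i : Fin N) (j : Fin J) : ℝ :=
  p.d j + ∑ k, p.A j k * p.Θ i k

/-- The norm constraints `√(1 + ‖θ_i‖²) ≤ C` and `√(d_j² + ‖a_j‖²) ≤ C`. -/
def Feasible (C : ℝ) (p : FactorParams N J K) : Prop :=
  (∀ i, Real.sqrt (1 + ∑ k, p.Θ i k ^ 2) ≤ C) ∧
    (∀ j, Real.sqrt (p.d j ^ 2 + ∑ k, p.A j k ^ 2) ≤ C)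

/-- The joint likelihood of the binary response matrix `y` (`true` codes the response 1). -/
def likelihood (f : ℝ → ℝ) (y : Fin N → Fin J → Bool) (p : FactorParams N J K) : ℝ :=
  ∏ i, ∏ j, if y i j then f (p.predictor i j) else 1 - f (p.predictor i j)

/-- `p` is a constrained joint maximum likelihood estimate from the response matrix `y`:
it maximizes the joint log-likelihood over all parameters satisfying the norm constraints. -/
def IsCJMLE (f : ℝ → ℝ) (C : ℝ) (y : Fin N → Fin J → Bool) (p : FactorParams N J K) : Prop :=
  p.Feasible C ∧
    ∀ q : FactorParams N J K, q.Feasible C →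
      Real.log (q.likelihood f y) ≤ Real.log (p.likelihood f y)

/-- The person parameters are standardized: each column of `Θ` is centered and has mean square 1,
and distinct columns are orthogonal. -/
def Standardized (p : FactorParams N J K) : Prop :=
  (∀ k, ∑ i, p.Θ i k = 0) ∧
    (∀ k, (1 / (N : ℝ)) * ∑ i, p.Θ i k * p.Θ i k = 1) ∧
    (∀ k k', k ≠ k' → ∑ i, p.Θ i k * p.Θ i k' = 0)

/-- `q` is a standardized version of `p`: it has the same linear predictors, i.e.
`Θ_q A_qᵀ + 1 d_qᵀ = Θ_p A_pᵀ + 1 d_pᵀ`, and its person parameters are standardized.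
(The matrix `A_q` is thereby determined up to right multiplication by an orthogonal matrix.) -/
def IsStandardization (p q : FactorParams N J K) : Prop :=
  q.Standardized ∧ ∀ i j, q.predictor i j = p.predictor i j

/-- Any `K` vectors lie in the span of `K` orthonormal ones, if the dimension permits. -/
theorem exists_orthonormal_span {H : Type*} [NormedAddCommGroup H] [InnerProductSpace ℝ H]
    [FiniteDimensional ℝ H] {K : ℕ} (hK : K ≤ Module.finrank ℝ H) (u : Fin K → H) :
    ∃ w : Fin K → H, Orthonormal ℝ w ∧ ∀ k, u k ∈ Submodule.span ℝ (Set.range w) := by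
  classical
  let W : Submodule ℝ H := Submodule.span ℝ (Set.range u)
  let b := stdOrthonormalBasis ℝ W
  have hWK : Module.finrank ℝ W ≤ K := by
    have := finrank_range_le_card (R := ℝ) u
    rwa [Fintype.card_fin] at this
  have hbo : Orthonormal ℝ (fun i => (b i : H)) := b.orthonormal.comp_linearIsometry W.subtypeₗᵢ
  obtain ⟨s, B, hs, hB⟩ := (hbo.toSubtypeRange).exists_orthonormalBasis_extension
  have hscard : s.card = Module.finrank ℝ H := by
    have := Module.finrank_eq_card_basis B.toBasis
    simpa only [Fintype.card_coe] using this.symm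
  let v : Finset H := Finset.univ.image fun i => (b i : H)
  have hvs : v ⊆ s := by
    intro x hx
    obtain ⟨i, -, rfl⟩ := Finset.mem_image.1 hx
    exact hs ⟨i, rfl⟩
  have hvc : v.card ≤ K := Finset.card_image_le.trans (by simpa using hWK)
  obtain ⟨t, hvt, hts, htc⟩ := Finset.exists_subsuperset_card_eq hvs hvc (by omega)
  let e : Fin K ≃ t := (finCongr htc.symm).trans t.equivFin.symm
  let w : Fin K → H := fun k => (e k : H)
  have hw : Orthonormal ℝ w := by
    have := B.orthonormal.comp (fun k : Fin K => (⟨e k, hts (e k).2⟩ : s)) (by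
      intro a c hac
      exact e.injective (Subtype.ext (by simpa using hac)))
    simpa [hB, Function.comp_def] using this
  refine ⟨w, hw, fun k => ?_⟩
  have huw : u k ∈ Submodule.span ℝ (Set.range w) := by
    have hk : u k ∈ W := Submodule.subset_span ⟨k, rfl⟩
    have h1 : (⟨u k, hk⟩ : W) = ∑ i, b.repr ⟨u k, hk⟩ i • b i := (b.sum_repr _).symm
    have h2 := congrArg (fun x : W => (x : H)) h1
    simp only [Submodule.coe_sum, Submodule.coe_smul] at h2
    rw [h2]
    refine Submodule.sum_mem _ fun i _ => Submodule.smul_mem _ _ (Submodule.subset_span ?_)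
    have hi : (b i : H) ∈ t := hvt (Finset.mem_image.2 ⟨i, Finset.mem_univ _, rfl⟩)
    exact ⟨e.symm ⟨_, hi⟩, by simp [w]⟩
  exact huw

/-- As soon as `K < N`, every `p` has a standardized version. -/
theorem exists_isStandardization (hN : K < N) (p : FactorParams N J K) :
    ∃ q, p.IsStandardization q := by
  classical
  have hN0 : (0 : ℝ) < N := by exact_mod_cast (Nat.zero_le K).trans_lt hN
  let one : EuclideanSpace ℝ (Fin N) := WithLp.toLp 2 fun _ => 1
  have hone : one ≠ 0 := by
    intro h
    have := congrArg (fun v : EuclideanSpace ℝ (Fin N) => v ⟨0, by omega⟩) h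
    simp [one] at this
  let H : Submodule ℝ (EuclideanSpace ℝ (Fin N)) := (ℝ ∙ one)ᗮ
  have hH : ∀ v : EuclideanSpace ℝ (Fin N), v ∈ H ↔ ∑ i, v i = 0 := by
    intro v
    rw [Submodule.mem_orthogonal_singleton_iff_inner_right]
    simp [one, PiLp.inner_apply]
  have hfin : Module.finrank ℝ H + 1 = N := by
    have h1 := Submodule.finrank_add_finrank_orthogonal (ℝ ∙ one)
    rw [finrank_span_singleton hone, finrank_euclideanSpace, Fintype.card_fin] at h1
    change Module.finrank ℝ ((ℝ ∙ one)ᗮ : Submodule ℝ _) + 1 = N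
    omega
  let m : Fin K → ℝ := fun k => (∑ i, p.Θ i k) / N
  let u : Fin K → H := fun k => ⟨WithLp.toLp 2 fun i => p.Θ i k - m k, by
    rw [hH]
    simp only [Finset.sum_sub_distrib, Finset.sum_const, Finset.card_univ, Fintype.card_fin,
      nsmul_eq_mul, m]
    field_simp
    simp⟩
  obtain ⟨w, hw, huw⟩ := exists_orthonormal_span (by omega : K ≤ Module.finrank ℝ H) u
  choose c hc using fun k => (Submodule.mem_span_range_iff_exists_fun ℝ).1 (huw k)
  have hci : ∀ k i, ∑ l, c k l * (w l : EuclideanSpace ℝ (Fin N)) i = p.Θ i k - m k := by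
    intro k i
    have := congrArg (fun x : H => (x : EuclideanSpace ℝ (Fin N)) i) (hc k)
    simpa [u] using this
  have hwo : ∀ k l, ∑ i, (w k : EuclideanSpace ℝ (Fin N)) i * (w l : EuclideanSpace ℝ (Fin N)) i
      = if k = l then 1 else 0 := by
    intro k l
    have := (orthonormal_iff_ite.1 hw) k l
    rw [← this, Submodule.coe_inner, PiLp.inner_apply]
    exact Finset.sum_congr rfl fun i _ => mul_comm _ _
  have hsq : Real.sqrt N * Real.sqrt N = N := Real.mul_self_sqrt hN0.le
  have hsq0 : Real.sqrt N ≠ 0 := (Real.sqrt_pos.2 hN0).ne'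
  have hmul : ∀ k l, ∑ i, (Real.sqrt N * (w k : EuclideanSpace ℝ (Fin N)) i) *
      (Real.sqrt N * (w l : EuclideanSpace ℝ (Fin N)) i) = N * if k = l then 1 else 0 := by
    intro k l
    rw [← hwo k l, Finset.mul_sum]
    exact Finset.sum_congr rfl fun i _ => by rw [mul_mul_mul_comm, hsq]
  refine ⟨⟨fun i k => Real.sqrt N * (w k : EuclideanSpace ℝ (Fin N)) i,
    fun j l => (∑ k, p.A j k * c k l) / Real.sqrt N, fun j => p.d j + ∑ k, p.A j k * m k⟩,
    ⟨?_, ?_, ?_⟩, ?_⟩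
  · intro k
    simp only [← Finset.mul_sum, (hH _).1 (w k).2, mul_zero]
  · intro k
    simp only [hmul, if_true, mul_one]
    field_simp
  · intro k l hkl
    simp only [hmul, if_neg hkl, mul_zero]
  · intro i j
    simp only [predictor]
    have h1 : ∀ l, (∑ k, p.A j k * c k l) / Real.sqrt N *
        (Real.sqrt N * (w l : EuclideanSpace ℝ (Fin N)) i) =
        ∑ k, p.A j k * (c k l * (w l : EuclideanSpace ℝ (Fin N)) i) := by
      intro l
      field_simp
      rw [Finset.sum_mul]
      exact Finset.sum_congr rfl fun k _ => by ring
    simp only [h1]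
    rw [Finset.sum_comm]
    simp only [← Finset.mul_sum, hci]
    rw [add_assoc, ← Finset.sum_add_distrib]
    congr 1
    exact Finset.sum_congr rfl fun k _ => by ring

end FactorParams

/-- Regularity of the link function `f` on `[-C², C²]`. That the suprema of the two quotients are
finite includes that the denominators do not vanish; `f` takes values in `(0, 1)` there because
its values are probabilities. -/
def RegularLink (f : ℝ → ℝ) (C : ℝ) : Prop :=
  Differentiable ℝ f ∧
    (∀ x, |x| ≤ C ^ 2 → 0 < f x ∧ f x < 1 ∧ deriv f x ≠ 0) ∧
    (∃ L : ℝ, ∀ x, |x| ≤ C ^ 2 → |deriv f x| / (f x * (1 - f x)) ≤ L) ∧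
    (∃ L : ℝ, ∀ x, |x| ≤ C ^ 2 → f x * (1 - f x) / deriv f x ^ 2 ≤ L)

/-- The binary responses `Y i j` are independent random variables and
`P(Y i j = 1) = f(d_j + a_jᵀ θ_i)`. -/
def IsFactorModel {N J K : ℕ} {Ω : Type*} [MeasurableSpace Ω] (P : Measure Ω) (f : ℝ → ℝ)
    (p : FactorParams N J K) (Y : Fin N → Fin J → Ω → Bool) : Prop :=
  (∀ i j, Measurable (Y i j)) ∧
    iIndepFun (fun (q : Fin N × Fin J) => Y q.1 q.2) P ∧
    ∀ i j, P.real {ω | Y i j ω = true} = f (p.predictor i j)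

/-- The `K`-th (i.e. smallest) singular value of a `J × K` matrix with `K ≥ 1`; Mathlib numbers
the singular values, in decreasing order, from 0. -/
def smallestSingularValue {J K : ℕ} (A : Matrix (Fin J) (Fin K) ℝ) : ℝ :=
  (Matrix.toEuclideanLin A).singularValues (K - 1)

/-- The scaled squared Frobenius distance `‖A - B Q‖_F² / (J K)`. -/
def scaledSqDist {J K : ℕ} (A B : Matrix (Fin J) (Fin K) ℝ) (Q : Matrix (Fin K) (Fin K) ℝ) : ℝ :=
  (1 / ((J : ℝ) * (K : ℝ))) * ∑ j, ∑ k, (A j k - (B * Q) j k) ^ 2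

/-- The scaled Frobenius loss `min { ‖A - B Q‖_F² / (J K) : Qᵀ Q = I }`. -/
def rotationLoss {J K : ℕ} (A B : Matrix (Fin J) (Fin K) ℝ) : ℝ :=
  sInf (scaledSqDist A B '' {Q : Matrix (Fin K) (Fin K) ℝ | Q.transpose * Q = 1})

/-- The infimum in `rotationLoss` is a minimum. -/
theorem rotationLoss_isLeast {J K : ℕ} (A B : Matrix (Fin J) (Fin K) ℝ) :
    IsLeast (scaledSqDist A B '' {Q : Matrix (Fin K) (Fin K) ℝ | Q.transpose * Q = 1})
      (rotationLoss A B) := by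
  have hsub : {Q : Matrix (Fin K) (Fin K) ℝ | Q.transpose * Q = 1} ⊆
      Set.pi Set.univ fun _ => Set.pi Set.univ fun _ => Set.Icc (-1 : ℝ) 1 := by
    intro Q hQ i _ k _
    have h1 : ∑ l, Q l k * Q l k = 1 := by
      have := congrFun (congrFun hQ k) k
      simpa [Matrix.mul_apply] using this
    have h2 : Q i k * Q i k ≤ 1 := by
      rw [← h1]
      exact Finset.single_le_sum (f := fun l => Q l k * Q l k)
        (fun l _ => mul_self_nonneg _) (Finset.mem_univ i)
    exact ⟨by nlinarith, by nlinarith⟩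
  have hcl : IsClosed {Q : Matrix (Fin K) (Fin K) ℝ | Q.transpose * Q = 1} :=
    isClosed_eq (by fun_prop) continuous_const
  have hK : IsCompact {Q : Matrix (Fin K) (Fin K) ℝ | Q.transpose * Q = 1} :=
    (isCompact_univ_pi fun _ => isCompact_univ_pi fun _ => isCompact_Icc).of_isClosed_subset
      hcl hsub
  have hc : Continuous (scaledSqDist A B) := by
    unfold scaledSqDist
    simp only [Matrix.mul_apply]
    fun_prop
  exact (hK.image hc).isLeast_sInf ⟨_, 1, by simp, rfl⟩

end

/-! The likelihood determines the linear predictors in mean square, and standardization reads the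
loadings off the predictors.

Likelihood: in each entry, the log-likelihood gain of the estimate over the truth is noise times a
difference of log-odds, minus a Bernoulli Kullback-Leibler divergence. The total gain is nonnegative
and the divergence dominates the squared predictor error, so a linear functional of the noise bounds
that error (`exists_mul_sum_sq_le`). Its coefficients depend on one point per row and one per
column, taken from fixed compact sets. On a finite grid the number of choices is exponential in N +
J, while Hoeffding tails are exponentially small in NJ (`tendsto_measure_exists_le_sum`).

Geometry: put G = Θ̃ᵀΘ*/N. Multiplying the two nearby predictor matrices by Θ*ᵀ/N and by Θ̃ᵀ/N gives
A* ≈ ÃG and Ã ≈ A*Gᵀ, hence A*(1 - GᵀG) ≈ 0. The bound on the smallest singular value of A* makes G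
almost orthogonal, and an orthogonal Q near G is the required rotation (`exists_rotationLoss_lt`).
-/

section Frobenius

-- Matrix geometry: from predictors to loadings

attribute [local instance] Matrix.frobeniusNormedAddCommGroup Matrix.frobeniusNormedSpace

theorem Matrix.frobenius_norm_sq {m n : Type*} [Fintype m] [Fintype n] (A : Matrix m n ℝ) :
    ‖A‖ ^ 2 = ∑ i, ∑ j, A i j ^ 2 := by
  rw [Matrix.frobenius_norm_def, ← Real.sqrt_eq_rpow, Real.sq_sqrt (by positivity)]
  simp

/-- The smallest singular value is a lower bound for the expansion of vectors. -/
theorem smallestSingularValue_sq_mul_norm_sq_le {J K : ℕ} (hK : 1 ≤ K)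
    (A : Matrix (Fin J) (Fin K) ℝ) (v : EuclideanSpace ℝ (Fin K)) :
    smallestSingularValue A ^ 2 * ‖v‖ ^ 2 ≤ ‖Matrix.toEuclideanLin A v‖ ^ 2 := by
  set T := Matrix.toEuclideanLin A with hT
  have hn : Module.finrank ℝ (EuclideanSpace ℝ (Fin K)) = K := by simp
  have hS := T.isSymmetric_adjoint_comp_self
  set b := hS.eigenvectorBasis hn with hb
  have h1 : ‖T v‖ ^ 2 = ∑ i, hS.eigenvalues hn i * inner ℝ (b i) v ^ 2 := by
    rw [← real_inner_self_eq_norm_sq, ← LinearMap.adjoint_inner_right, ← b.sum_inner_mul_inner]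
    refine Finset.sum_congr rfl fun i _ => ?_
    have := hS (b i) v
    simp only [LinearMap.comp_apply] at this
    rw [← this]
    have h2 := hS.apply_eigenvectorBasis hn i
    simp only [LinearMap.comp_apply] at h2
    rw [h2, inner_smul_left, real_inner_comm v]
    simp
    ring
  have h2 : ‖v‖ ^ 2 = ∑ i, inner ℝ (b i) v ^ 2 := by
    rw [← b.sum_sq_norm_inner_right v]
    simp
  rw [h1, h2, Finset.mul_sum]
  refine Finset.sum_le_sum fun i _ => mul_le_mul_of_nonneg_right ?_ (sq_nonneg _)
  -- The eigenvalues of `T`* `T` are the squared singular values; these decrease, so index `K - 1`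
  -- is the least of those with `i < K`.
  rw [← T.sq_singularValues_fin hn i]
  exact pow_le_pow_left₀ (T.singularValues_nonneg _)
    (T.singularValues_antitone (by have := i.2; omega)) 2

theorem smallestSingularValue_mul_norm_le {J K L : ℕ} (hK : 1 ≤ K)
    (A : Matrix (Fin J) (Fin K) ℝ) (B : Matrix (Fin K) (Fin L) ℝ) :
    smallestSingularValue A * ‖B‖ ≤ ‖A * B‖ := by
  refine le_of_sq_le_sq ?_ (norm_nonneg _)
  rw [mul_pow, Matrix.frobenius_norm_sq, Matrix.frobenius_norm_sq, Finset.sum_comm,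
    Finset.sum_comm (s := (Finset.univ : Finset (Fin J))), Finset.mul_sum]
  refine Finset.sum_le_sum fun l _ => ?_
  have := smallestSingularValue_sq_mul_norm_sq_le hK A (WithLp.toLp 2 fun k => B k l)
  rw [EuclideanSpace.norm_sq_eq, EuclideanSpace.norm_sq_eq] at this
  simpa [Matrix.toLpLin_apply, Matrix.mulVec, dotProduct, Matrix.mul_apply] using this

/-- A bounded matrix which is almost orthogonal is close to an orthogonal matrix. -/
theorem exists_orthogonal_near (K : ℕ) (R : ℝ) {ε : ℝ} (hε : 0 < ε) :
    ∃ η : ℝ, 0 < η ∧ ∀ G : Matrix (Fin K) (Fin K) ℝ, ‖G‖ ≤ R →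
      ‖1 - G.transpose * G‖ < η →
        ∃ Q : Matrix (Fin K) (Fin K) ℝ, Q.transpose * Q = 1 ∧ ‖Q - G‖ < ε := by
  -- `S` collects the bounded matrices at distance at least `ε` from every orthogonal one. It is
  -- compact, and the orthogonality defect has no zero on it.
  let S : Set (Matrix (Fin K) (Fin K) ℝ) := Metric.closedBall 0 R ∩
    ⋂ Q ∈ {Q : Matrix (Fin K) (Fin K) ℝ | Q.transpose * Q = 1}, {G | ε ≤ ‖Q - G‖}
  have : ProperSpace (Matrix (Fin K) (Fin K) ℝ) := FiniteDimensional.proper ℝ _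
  have hS : IsCompact S := (isCompact_closedBall _ _).inter_right <|
    isClosed_biInter fun Q _ => isClosed_le continuous_const (by fun_prop)
  have hcont : Continuous fun G : Matrix (Fin K) (Fin K) ℝ => ‖1 - G.transpose * G‖ := by
    fun_prop
  have key : ∃ η : ℝ, 0 < η ∧ ∀ G ∈ S, η ≤ ‖1 - G.transpose * G‖ := by
    rcases S.eq_empty_or_nonempty with h | h
    · exact ⟨1, one_pos, by simp [h]⟩
    obtain ⟨G₀, hG₀, hmin⟩ := hS.exists_isMinOn h hcont.continuousOn
    refine ⟨_, norm_pos_iff.2 fun h0 => ?_, fun G hG => hmin hG⟩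
    have h1 : ε ≤ ‖G₀ - G₀‖ :=
      Set.mem_iInter₂.1 hG₀.2 G₀ (sub_eq_zero.1 h0).symm
    simp at h1
    linarith
  obtain ⟨η, hη, h⟩ := key
  refine ⟨η, hη, fun G hG hGη => ?_⟩
  by_contra! hcon
  exact absurd (h G ⟨by simpa using hG, Set.mem_iInter₂.2 fun Q hQ => hcon Q hQ⟩) (not_le.2 hGη)

namespace FactorParams

variable {N J K : ℕ}

theorem Standardized.norm_sq {p : FactorParams N J K} (hp : p.Standardized) (hN : 0 < N) :
    ‖p.Θ‖ ^ 2 = N * K := by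
  have hN' : (N : ℝ) ≠ 0 := by positivity
  have h : ∀ k, ∑ i, p.Θ i k ^ 2 = N := fun k => by
    have := hp.2.1 k
    field_simp at this
    simpa [pow_two] using this
  rw [Matrix.frobenius_norm_sq, Finset.sum_comm]
  simp [h, mul_comm]

theorem Standardized.transpose_mul {p : FactorParams N J K} (hp : p.Standardized) (hN : 0 < N) :
    p.Θ.transpose * p.Θ = (N : ℝ) • (1 : Matrix (Fin K) (Fin K) ℝ) := by
  have hN' : (N : ℝ) ≠ 0 := by positivity
  ext k l
  rw [Matrix.mul_apply]
  rcases eq_or_ne k l with rfl | hkl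
  · have := hp.2.1 k
    field_simp at this
    simpa [pow_two] using this
  · simpa [Matrix.one_apply, hkl] using hp.2.2 k l hkl

/-- The matrix of linear predictors. -/
def predictorMatrix (p : FactorParams N J K) : Matrix (Fin N) (Fin J) ℝ :=
  Matrix.of p.predictor

/-- Centered columns annihilate the intercepts. For `q = p` the right side is N times the transposed
loadings. -/
theorem transpose_mul_predictorMatrix {p : FactorParams N J K} (hp : p.Standardized)
    (q : FactorParams N J K) :
    p.Θ.transpose * q.predictorMatrix = p.Θ.transpose * q.Θ * q.A.transpose := by
  ext k j
  have h : ∀ i, p.Θ i k * q.predictor i j =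
      p.Θ i k * q.d j + p.Θ i k * ∑ l, q.Θ i l * q.A j l := fun i => by
    rw [predictor, mul_add]
    simp only [mul_comm]
  rw [Matrix.mul_assoc]
  simp only [predictorMatrix, Matrix.mul_apply, Matrix.transpose_apply, Matrix.of_apply, h,
    Finset.sum_add_distrib, ← Finset.sum_mul, hp.1 k, zero_mul, zero_add]

theorem Feasible.norm_A_le {C : ℝ} (hC : 0 < C) {p : FactorParams N J K} (hp : p.Feasible C) :
    ‖p.A‖ ≤ C * √J := by
  refine le_of_sq_le_sq ?_ (by positivity)
  rw [Matrix.frobenius_norm_sq, mul_pow, Real.sq_sqrt (by positivity)]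
  calc _ ≤ ∑ _j : Fin J, C ^ 2 := Finset.sum_le_sum fun j _ => by
        have := (Real.sqrt_le_left hC.le).1 (hp.2 j)
        nlinarith [sq_nonneg (p.d j)]
    _ = C ^ 2 * J := by simp [mul_comm]

theorem rotationLoss_le {J K : ℕ} (A B : Matrix (Fin J) (Fin K) ℝ)
    {Q : Matrix (Fin K) (Fin K) ℝ} (hQ : Q.transpose * Q = 1) :
    rotationLoss A B ≤ 1 / ((J : ℝ) * K) * ‖A - B * Q‖ ^ 2 := by
  rw [Matrix.frobenius_norm_sq]
  exact (rotationLoss_isLeast A B).2 ⟨Q, hQ, rfl⟩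

/-- Submultiplicativity together with ‖Θ‖² = NK; the factor `K` in `hD` absorbs the one in this
norm. -/
theorem Standardized.norm_smul_transpose_mul_le {p : FactorParams N J K} (hp : p.Standardized)
    (hN : 0 < N) {η : ℝ} (hη : 0 ≤ η) (D : Matrix (Fin N) (Fin J) ℝ)
    (hD : K * ‖D‖ ^ 2 ≤ η ^ 2 * N * J) :
    ‖(N : ℝ)⁻¹ • (p.Θ.transpose * D)‖ ≤ η * √J := by
  have hN' : (0 : ℝ) < N := by positivity
  rw [norm_smul, norm_inv, Real.norm_of_nonneg hN'.le, inv_mul_le_iff₀ hN']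
  refine (Matrix.frobenius_norm_mul _ _).trans ?_
  rw [Matrix.frobenius_norm_transpose]
  refine le_of_sq_le_sq ?_ (by positivity)
  rw [mul_pow, hp.norm_sq hN]
  simp only [mul_pow, Real.sq_sqrt (Nat.cast_nonneg (α := ℝ) J)]
  nlinarith

/-- If the linear predictors of two standardized parameters are close in mean square, then so are
their loadings up to rotation. -/
theorem exists_rotationLoss_lt (hK : 1 ≤ K) {C : ℝ} (hC : 0 < C) {C₃ : ℝ} (hC₃ : 0 < C₃) {ε : ℝ}
    (hε : 0 < ε) :
    ∃ δ : ℝ, 0 < δ ∧ ∀ (N J : ℕ), 0 < N → 0 < J → ∀ p q : FactorParams N J K,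
      p.Standardized → q.Standardized → p.Feasible C → C₃ * √J ≤ smallestSingularValue p.A →
      ∑ i, ∑ j, (q.predictor i j - p.predictor i j) ^ 2 ≤ δ * (N * J) →
        rotationLoss p.A q.A < ε := by
  have hK' : (1 : ℝ) ≤ K := by exact_mod_cast hK
  -- In the final estimate `C * K + 1` bounds ‖Ã‖/√J, `ε₁` bounds ‖Q - G‖, and the last `ε₁` bounds
  -- `η`.
  obtain ⟨ε₁, hε₁, hε₁'⟩ : ∃ ε₁ : ℝ, 0 < ε₁ ∧ ((C * K + 1) * ε₁ + ε₁) ^ 2 < ε := by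
    have : Tendsto (fun x : ℝ => ((C * K + 1) * x + x) ^ 2) (𝓝[>] 0) (𝓝 0) := by
      refine tendsto_nhdsWithin_of_tendsto_nhds ?_
      have : Continuous (fun x : ℝ => ((C * K + 1) * x + x) ^ 2) := by fun_prop
      simpa using this.tendsto 0
    obtain ⟨x, hx, hx0⟩ := ((this.eventually (gt_mem_nhds hε)).and self_mem_nhdsWithin).exists
    exact ⟨x, hx0, hx⟩
  obtain ⟨η₁, hη₁, horth⟩ := exists_orthogonal_near K K hε₁
  -- `η` is the error in both relations between the loadings, in units of √J. The last condition
  -- controls the orthogonality defect of `G`.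
  obtain ⟨η, hη, hη1, hηε, hηη⟩ : ∃ η : ℝ, 0 < η ∧ η ≤ 1 ∧ η ≤ ε₁ ∧ η * (1 + K) / C₃ < η₁ := by
    refine ⟨min 1 (min ε₁ (η₁ * C₃ / (1 + K) / 2)), by positivity, min_le_left _ _,
      (min_le_right _ _).trans (min_le_left _ _), ?_⟩
    rw [div_lt_iff₀ hC₃, ← lt_div_iff₀ (by positivity)]
    have : 0 < η₁ * C₃ / (1 + K) := by positivity
    exact ((min_le_right _ _).trans (min_le_right _ _)).trans_lt (by linarith)
  refine ⟨η ^ 2 / K, by positivity, fun N J hN hJ p q hp hq hpC hσ hd => ?_⟩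
  have hN' : (0 : ℝ) < N := by positivity
  have hJ' : (0 : ℝ) < √J := by positivity
  set D := q.predictorMatrix - p.predictorMatrix with hD
  have hDn : K * ‖D‖ ^ 2 ≤ η ^ 2 * N * J := by
    rw [Matrix.frobenius_norm_sq]
    have : ∑ i, ∑ j, D i j ^ 2 ≤ η ^ 2 / K * (N * J) := hd
    rw [div_mul_eq_mul_div, le_div_iff₀ (by positivity)] at this
    linarith
  set G : Matrix (Fin K) (Fin K) ℝ := (N : ℝ)⁻¹ • (q.Θ.transpose * p.Θ) with hG
  have hGK : ‖G‖ ≤ K := by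
    rw [hG, norm_smul, norm_inv, Real.norm_of_nonneg hN'.le, inv_mul_le_iff₀ hN']
    refine (Matrix.frobenius_norm_mul _ _).trans ?_
    rw [Matrix.frobenius_norm_transpose]
    nlinarith [sq_nonneg (‖q.Θ‖ - ‖p.Θ‖), hp.norm_sq hN, hq.norm_sq hN]
  have h1 : ‖q.A - p.A * G.transpose‖ ≤ η * √J := by
    rw [← Matrix.frobenius_norm_transpose]
    refine le_of_eq_of_le (congrArg norm ?_) (hq.norm_smul_transpose_mul_le hN hη.le D hDn)
    rw [hD, Matrix.mul_sub, transpose_mul_predictorMatrix hq, transpose_mul_predictorMatrix hq,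
      hq.transpose_mul hN, smul_sub, Matrix.transpose_sub, Matrix.transpose_mul,
      Matrix.transpose_transpose, hG, Matrix.smul_mul, Matrix.smul_mul, smul_smul,
      inv_mul_cancel₀ hN'.ne', one_smul, Matrix.one_mul]
  have h2 : ‖p.A - q.A * G‖ ≤ η * √J := by
    rw [← Matrix.frobenius_norm_transpose, ← norm_neg]
    refine le_of_eq_of_le (congrArg norm ?_) (hp.norm_smul_transpose_mul_le hN hη.le D hDn)
    rw [hD, Matrix.mul_sub, transpose_mul_predictorMatrix hp, transpose_mul_predictorMatrix hp,
      hp.transpose_mul hN, smul_sub, Matrix.transpose_sub, Matrix.transpose_mul, hG,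
      Matrix.transpose_smul, Matrix.transpose_mul, Matrix.transpose_transpose, Matrix.smul_mul,
      Matrix.smul_mul, smul_smul, inv_mul_cancel₀ hN'.ne', one_smul, Matrix.one_mul, neg_sub]
  have h3 : ‖1 - G.transpose * G‖ < η₁ := by
    refine lt_of_le_of_lt ?_ hηη
    rw [le_div_iff₀ hC₃]
    have h4 := smallestSingularValue_mul_norm_le hK p.A (1 - G.transpose * G)
    have h5 : p.A * (1 - G.transpose * G) =
        (p.A - q.A * G) + (q.A - p.A * G.transpose) * G := by
      rw [Matrix.mul_sub, Matrix.sub_mul, Matrix.mul_one, Matrix.mul_assoc]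
      abel
    have h6 : ‖p.A * (1 - G.transpose * G)‖ ≤ η * √J + η * √J * K := by
      rw [h5]
      refine (norm_add_le _ _).trans (add_le_add h2 ((Matrix.frobenius_norm_mul _ _).trans ?_))
      gcongr
    have h7 : C₃ * √J * ‖1 - G.transpose * G‖ ≤ η * √J + η * √J * K :=
      (mul_le_mul_of_nonneg_right hσ (norm_nonneg _)).trans (h4.trans h6)
    refine le_of_mul_le_mul_left ?_ hJ'
    linarith
  obtain ⟨Q, hQ, hQG⟩ := horth G hGK h3
  -- The standardized estimate need not satisfy the norm constraints, so its loadings are bounded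
  -- through those of `p`.
  have hqA : ‖q.A‖ ≤ (C * K + 1) * √J := by
    have h4 : q.A = (q.A - p.A * G.transpose) + p.A * G.transpose := by abel
    have h5 : ‖p.A * G.transpose‖ ≤ C * √J * K := by
      refine (Matrix.frobenius_norm_mul _ _).trans ?_
      rw [Matrix.frobenius_norm_transpose]
      gcongr
      exact hpC.norm_A_le hC
    rw [h4]
    refine (norm_add_le _ _).trans ((add_le_add h1 h5).trans ?_)
    nlinarith
  have h4 : ‖p.A - q.A * Q‖ ≤ ((C * K + 1) * ε₁ + ε₁) * √J := by
    have h5 : p.A - q.A * Q = (p.A - q.A * G) - q.A * (Q - G) := by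
      rw [Matrix.mul_sub]
      abel
    have h6 : ‖q.A * (Q - G)‖ ≤ (C * K + 1) * √J * ε₁ := by
      refine (Matrix.frobenius_norm_mul _ _).trans ?_
      gcongr
    rw [h5]
    refine (norm_sub_le _ _).trans ((add_le_add h2 h6).trans ?_)
    nlinarith
  refine (rotationLoss_le p.A q.A hQ).trans_lt (lt_of_le_of_lt ?_ hε₁')
  have hJK : (0 : ℝ) < J * K := by positivity
  rw [one_div, inv_mul_le_iff₀ hJK]
  refine (pow_le_pow_left₀ (norm_nonneg _) h4 2).trans ?_
  rw [mul_pow, Real.sq_sqrt (by positivity)]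
  have : (0 : ℝ) ≤ J * ((C * K + 1) * ε₁ + ε₁) ^ 2 := by positivity
  nlinarith

end FactorParams

end Frobenius

/-! ### The basic inequality for the likelihood -/

/-- The Kullback-Leibler divergence of two Bernoulli distributions dominates the squared distance
of their means. -/
theorem sq_sub_div_four_le_bernoulli_kl {p q : ℝ} (hp : 0 < p) (hp1 : p < 1) (hq : 0 < q)
    (hq1 : q < 1) :
    (p - q) ^ 2 / 4 ≤
      p * (Real.log p - Real.log q) + (1 - p) * (Real.log (1 - p) - Real.log (1 - q)) := by
  -- This is log t ≤ t - 1 at t = √(y/x). Added for the two outcomes, it bounds the divergence below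
  -- by the squared Hellinger distance (√p - √q)² + (√(1-p) - √(1-q))².
  have key : ∀ x y : ℝ, 0 < x → 0 < y → 2 * (x - √x * √y) ≤ x * (Real.log x - Real.log y) := by
    intro x y hx hy
    have hx' := Real.sqrt_pos.2 hx
    have hy' := Real.sqrt_pos.2 hy
    have h1 := Real.log_le_sub_one_of_pos (div_pos hy' hx')
    rw [Real.log_div hy'.ne' hx'.ne', Real.log_sqrt hx.le, Real.log_sqrt hy.le] at h1
    have h2 : x * (√y / √x) = √x * √y := by
      nth_rewrite 1 [← Real.mul_self_sqrt hx.le]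
      field_simp
    nlinarith
  have h1 := key p q hp hq
  have h2 := key (1 - p) (1 - q) (by linarith) (by linarith)
  have a1 := Real.sq_sqrt hp.le
  have a2 := Real.sq_sqrt hq.le
  have a3 := Real.sq_sqrt (by linarith : 0 ≤ 1 - p)
  have a4 := Real.sq_sqrt (by linarith : 0 ≤ 1 - q)
  have b1 : √p ≤ 1 := Real.sqrt_le_one.2 hp1.le
  have b2 : √q ≤ 1 := Real.sqrt_le_one.2 hq1.le
  have h3 : (p - q) ^ 2 ≤ 4 * (√p - √q) ^ 2 := by
    have h4 : (p - q) ^ 2 = (√p - √q) ^ 2 * (√p + √q) ^ 2 := by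
      rw [← mul_pow, ← a1, ← a2]
      simp only [Real.sqrt_sq (Real.sqrt_nonneg _)]
      ring
    have h5 : (√p + √q) ^ 2 ≤ 4 := by nlinarith [Real.sqrt_nonneg p, Real.sqrt_nonneg q]
    rw [h4]
    nlinarith [sq_nonneg (√p - √q)]
  nlinarith [sq_nonneg (√(1 - p) - √(1 - q))]

/-- The log-odds of the response probabilities given by a link function. -/
noncomputable def logOdds (f : ℝ → ℝ) (x : ℝ) : ℝ := Real.log (f x) - Real.log (1 - f x)

namespace RegularLink

variable {f : ℝ → ℝ} {C : ℝ}

theorem continuousOn_logOdds (hf : RegularLink f C) :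
    ContinuousOn (logOdds f) {x | |x| ≤ C ^ 2} := by
  have hc : Continuous f := hf.1.continuous
  unfold logOdds
  exact (hc.continuousOn.log fun x hx => (hf.2.1 x hx).1.ne').sub
    ((continuous_const.sub hc).continuousOn.log fun x hx =>
      (sub_pos.2 (hf.2.1 x hx).2.1).ne')

/-- A regular link function expands distances at least by a constant factor. -/
theorem exists_mul_sq_sub_le (hf : RegularLink f C) :
    ∃ c : ℝ, 0 < c ∧ ∀ x y, |x| ≤ C ^ 2 → |y| ≤ C ^ 2 → c * (x - y) ^ 2 ≤ (f x - f y) ^ 2 := by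
  obtain ⟨hd, hpos, -, L, hL⟩ := hf
  have hc : Continuous f := hd.continuous
  have hmem : ∀ x, x ∈ Set.Icc (-C ^ 2) (C ^ 2) ↔ |x| ≤ C ^ 2 := fun x => abs_le.symm
  have h0 : (0 : ℝ) ∈ Set.Icc (-C ^ 2) (C ^ 2) := by rw [hmem]; simpa using sq_nonneg C
  obtain ⟨x₀, hx₀, hmin⟩ := isCompact_Icc.exists_isMinOn ⟨0, h0⟩
    (by fun_prop : ContinuousOn (fun x => f x * (1 - f x)) (Set.Icc (-C ^ 2) (C ^ 2)))
  have hv : ∀ x, |x| ≤ C ^ 2 → 0 < f x * (1 - f x) := fun x hx =>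
    mul_pos (hpos x hx).1 (sub_pos.2 (hpos x hx).2.1)
  have hm := hv x₀ ((hmem _).1 hx₀)
  set m := f x₀ * (1 - f x₀) with hmdef
  -- With `m` the minimal variance f(1 - f), the bound on f(1 - f)/f'² keeps f'² above m/L; the mean
  -- value theorem then gives the expansion.
  have hderiv : ∀ x, |x| ≤ C ^ 2 → m ≤ L * deriv f x ^ 2 := fun x hx => by
    have h1 := hL x hx
    have h2 : 0 < deriv f x ^ 2 := by have := (hpos x hx).2.2; positivity
    rw [div_le_iff₀ h2] at h1
    exact (hmin ((hmem _).2 hx)).trans h1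
  have hL0 : 0 < L := by
    have := hderiv _ ((hmem _).1 h0)
    by_contra! hL0
    nlinarith [sq_nonneg (deriv f 0)]
  have key : ∀ x y, |x| ≤ C ^ 2 → |y| ≤ C ^ 2 → x < y → m / L * (x - y) ^ 2 ≤ (f x - f y) ^ 2 := by
    intro x y hx hy hxy
    obtain ⟨z, hz, hzd⟩ := exists_deriv_eq_slope f hxy hc.continuousOn hd.differentiableOn
    have hz' : |z| ≤ C ^ 2 := abs_le.2
      ⟨(abs_le.1 hx).1.trans hz.1.le, hz.2.le.trans (abs_le.1 hy).2⟩
    have h1 : f y - f x = deriv f z * (y - x) := by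
      rw [hzd, div_mul_cancel₀ _ (sub_pos.2 hxy).ne']
    have h2 : (f x - f y) ^ 2 = deriv f z ^ 2 * (x - y) ^ 2 := by
      rw [← neg_sub, h1]
      ring
    rw [h2]
    refine mul_le_mul_of_nonneg_right ?_ (sq_nonneg _)
    rw [div_le_iff₀ hL0, mul_comm]
    exact hderiv z hz'
  refine ⟨m / L, by positivity, fun x y hx hy => ?_⟩
  rcases lt_trichotomy x y with h | rfl | h
  · exact key x y hx hy h
  · simp
  · rw [← neg_sub y x, ← neg_sub (f y), neg_sq, neg_sq]
    exact key y x hy hx h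

end RegularLink

namespace FactorParams

variable {N J K : ℕ} {f : ℝ → ℝ} {C : ℝ}

/-- The person parameters allowed by the norm constraint. -/
def personBall (K : ℕ) (C : ℝ) : Set (Fin K → ℝ) := {θ | √(1 + ∑ k, θ k ^ 2) ≤ C}

/-- The item parameters (loadings and intercept) allowed by the norm constraint. -/
def itemBall (K : ℕ) (C : ℝ) : Set ((Fin K → ℝ) × ℝ) := {b | √(b.2 ^ 2 + ∑ k, b.1 k ^ 2) ≤ C}

/-- The linear predictor of one response as a function of person and item parameters. -/
def linearPredictor (θ : Fin K → ℝ) (b : (Fin K → ℝ) × ℝ) : ℝ := b.2 + ∑ k, b.1 k * θ k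

theorem isCompact_personBall (K : ℕ) (C : ℝ) : IsCompact (personBall K C) := by
  refine (isCompact_univ_pi fun _ => isCompact_Icc (a := -C) (b := C)).of_isClosed_subset
    (isClosed_le (by fun_prop) continuous_const) fun θ hθ k _ => abs_le.1 ?_
  refine (Real.abs_le_sqrt ?_).trans hθ
  have := Finset.single_le_sum (f := fun k => θ k ^ 2) (fun _ _ => sq_nonneg _)
    (Finset.mem_univ k)
  linarith

theorem isCompact_itemBall (K : ℕ) (C : ℝ) : IsCompact (itemBall K C) := by
  refine ((isCompact_univ_pi fun _ => isCompact_Icc (a := -C) (b := C)).prod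
    (isCompact_Icc (a := -C) (b := C))).of_isClosed_subset
    (isClosed_le (by fun_prop) continuous_const) fun b hb => ⟨fun k _ => abs_le.1 ?_, abs_le.1 ?_⟩
  · refine (Real.abs_le_sqrt ?_).trans hb
    have := Finset.single_le_sum (f := fun k => b.1 k ^ 2) (fun _ _ => sq_nonneg _)
      (Finset.mem_univ k)
    nlinarith [sq_nonneg b.2]
  · refine (Real.abs_le_sqrt ?_).trans hb
    have := Finset.sum_nonneg (s := Finset.univ) fun k _ => sq_nonneg (b.1 k)
    linarith

/-- Cauchy-Schwarz for the vectors (d, a) and (1, θ), indexed by `Option (Fin K)`. -/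
theorem abs_linearPredictor_le (hC : 0 < C) {θ : Fin K → ℝ} {b : (Fin K → ℝ) × ℝ}
    (hθ : θ ∈ personBall K C) (hb : b ∈ itemBall K C) : |linearPredictor θ b| ≤ C ^ 2 := by
  have h1 := (Real.sqrt_le_left hC.le).1 hθ
  have h2 := (Real.sqrt_le_left hC.le).1 hb
  have h3 := Finset.sum_mul_sq_le_sq_mul_sq (Finset.univ : Finset (Option (Fin K)))
    (fun o => o.elim b.2 b.1) (fun o => o.elim 1 θ)
  simp only [Fintype.sum_option, Option.elim_none, Option.elim_some, mul_one, one_pow] at h3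
  refine abs_le_of_sq_le_sq (h3.trans ?_) (sq_nonneg C)
  rw [pow_two (C ^ 2)]
  exact mul_le_mul h2 h1 (by positivity) (sq_nonneg C)

theorem Feasible.abs_predictor_le (hC : 0 < C) {p : FactorParams N J K} (hp : p.Feasible C)
    (i : Fin N) (j : Fin J) : |p.predictor i j| ≤ C ^ 2 :=
  abs_linearPredictor_le (θ := p.Θ i) (b := (p.A j, p.d j)) hC (hp.1 i) (hp.2 j)

theorem log_likelihood (hC : 0 < C) (hf : RegularLink f C) {p : FactorParams N J K}
    (hp : p.Feasible C) (y : Fin N → Fin J → Bool) :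
    Real.log (p.likelihood f y) = ∑ i, ∑ j, if y i j then Real.log (f (p.predictor i j))
      else Real.log (1 - f (p.predictor i j)) := by
  have hne : ∀ i j, (if y i j then f (p.predictor i j) else 1 - f (p.predictor i j)) ≠ 0 := by
    intro i j
    obtain ⟨h1, h2, -⟩ := hf.2.1 _ (hp.abs_predictor_le hC i j)
    split_ifs
    exacts [h1.ne', (sub_pos.2 h2).ne']
  rw [likelihood, Real.log_prod fun i _ => Finset.prod_ne_zero_iff.2 fun j _ => hne i j]
  refine Finset.sum_congr rfl fun i _ => ?_
  rw [Real.log_prod fun j _ => hne i j]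
  exact Finset.sum_congr rfl fun j _ => apply_ite _ _ _ _

/-- The basic inequality: the error of the predictors of a constrained maximum likelihood estimate
is bounded by a linear functional of the noise. -/
theorem exists_mul_sum_sq_le (hC : 0 < C) (hf : RegularLink f C) :
    ∃ c : ℝ, 0 < c ∧ ∀ (N J : ℕ) (y : Fin N → Fin J → Bool) (p q : FactorParams N J K),
      p.Feasible C → q.IsCJMLE f C y →
      c * ∑ i, ∑ j, (q.predictor i j - p.predictor i j) ^ 2 ≤
        ∑ i, ∑ j, ((if y i j then 1 else 0) - f (p.predictor i j)) *
          (logOdds f (q.predictor i j) - logOdds f (p.predictor i j)) := by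
  obtain ⟨c, hc, h⟩ := hf.exists_mul_sq_sub_le
  refine ⟨c / 4, by positivity, fun N J y p q hp hq => ?_⟩
  have h1 := hq.2 p hp
  rw [log_likelihood hC hf hp, log_likelihood hC hf hq.1, ← sub_nonneg,
    ← Finset.sum_sub_distrib] at h1
  simp only [← Finset.sum_sub_distrib] at h1
  rw [← sub_nonneg, Finset.mul_sum, ← Finset.sum_sub_distrib]
  simp only [Finset.mul_sum, ← Finset.sum_sub_distrib]
  -- Termwise, the gain equals noise times log-odds difference minus divergence, and the divergence
  -- is at least `c / 4` times the squared predictor error.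
  refine h1.trans (Finset.sum_le_sum fun i _ => Finset.sum_le_sum fun j _ => ?_)
  have hp' := hp.abs_predictor_le hC i j
  have hq' := hq.1.abs_predictor_le hC i j
  obtain ⟨a1, a2, -⟩ := hf.2.1 _ hp'
  obtain ⟨b1, b2, -⟩ := hf.2.1 _ hq'
  have h3 := sq_sub_div_four_le_bernoulli_kl a1 a2 b1 b2
  have h4 := h _ _ hq' hp'
  unfold logOdds
  split_ifs <;> nlinarith

end FactorParams

/-! ### A uniform law of large numbers for double arrays -/

theorem IsCompact.exists_finset_dist_lt {α : Type*} [PseudoMetricSpace α] {X : Set α}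
    (hX : IsCompact X) {δ : ℝ} (hδ : 0 < δ) :
    ∃ (S : Finset α) (r : α → α), (S : Set α) ⊆ X ∧ ∀ x ∈ X, r x ∈ S ∧ dist x (r x) < δ := by
  obtain ⟨t, htX, ht, hcover⟩ := hX.finite_cover_balls hδ
  have h : ∀ x, ∃ x', x ∈ X → x' ∈ ht.toFinset ∧ dist x x' < δ := fun x => by
    by_cases hx : x ∈ X
    · obtain ⟨x', hx', hd⟩ := Set.mem_iUnion₂.1 (hcover hx)
      exact ⟨x', fun _ => ⟨by simpa using hx', hd⟩⟩
    · exact ⟨x, fun h => absurd h hx⟩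
  choose r hr using h
  exact ⟨ht.toFinset, r, by simpa using htX, hr⟩

/-- A continuous function on a product of compact sets is uniformly approximated by its values on
a finite grid. -/
theorem IsCompact.exists_finset_grid {α β : Type*} [PseudoMetricSpace α] [PseudoMetricSpace β]
    {X : Set α} {Y : Set β} (hX : IsCompact X) (hY : IsCompact Y) {φ : α → β → ℝ}
    (hφ : ContinuousOn (fun z : α × β => φ z.1 z.2) (X ×ˢ Y)) {ε : ℝ} (hε : 0 < ε) :
    ∃ (S : Finset α) (T : Finset β) (r : α → α) (s : β → β),
      (S : Set α) ⊆ X ∧ (T : Set β) ⊆ Y ∧ (∀ x ∈ X, r x ∈ S) ∧ (∀ y ∈ Y, s y ∈ T) ∧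
      ∀ x ∈ X, ∀ y ∈ Y, |φ x y - φ (r x) (s y)| ≤ ε := by
  obtain ⟨δ, hδ, hu⟩ := Metric.uniformContinuousOn_iff.1
    ((hX.prod hY).uniformContinuousOn_of_continuous hφ) ε hε
  obtain ⟨S, r, hSX, hr⟩ := hX.exists_finset_dist_lt hδ
  obtain ⟨T, s, hTY, hs⟩ := hY.exists_finset_dist_lt hδ
  refine ⟨S, T, r, s, hSX, hTY, fun x hx => (hr x hx).1, fun y hy => (hs y hy).1,
    fun x hx y hy => ?_⟩
  have := hu (x, y) ⟨hx, hy⟩ (r x, s y) ⟨hSX (hr x hx).1, hTY (hs y hy).1⟩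
    (max_lt (hr x hx).2 (hs y hy).2)
  exact (Real.dist_eq _ _ ▸ this).le

/-- The bound `sᴺ tᴶ exp (-c N J)` of a union bound over labelings of rows and columns vanishes. -/
theorem tendsto_pow_mul_pow_mul_exp_neg (s t : ℕ) {c : ℝ} (hc : 0 < c) :
    Tendsto (fun n : ℕ × ℕ => (s : ℝ) ^ n.1 * (t : ℝ) ^ n.2 * Real.exp (-(c * (n.1 * n.2))))
      atTop (𝓝 0) := by
  obtain ⟨l, hl⟩ := ((Real.tendsto_exp_atTop.eventually_ge_atTop (s : ℝ)).and
    (Real.tendsto_exp_atTop.eventually_ge_atTop (t : ℝ))).exists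
  have h1 : Tendsto (fun n : ℕ × ℕ => (n.1 : ℝ)) atTop atTop := by
    rw [← prod_atTop_atTop_eq]
    exact tendsto_natCast_atTop_atTop.comp tendsto_fst
  have h2 : Tendsto (fun n : ℕ × ℕ => (n.2 : ℝ)) atTop atTop := by
    rw [← prod_atTop_atTop_eq]
    exact tendsto_natCast_atTop_atTop.comp tendsto_snd
  refine squeeze_zero' (Eventually.of_forall fun n => by positivity) ?_
    (Real.tendsto_exp_neg_atTop_nhds_zero.comp h1)
  -- Half of cNJ dominates (l + 1)N and the other half (l + 1)J, which leaves at most -N in the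
  -- exponent.
  filter_upwards [h1.eventually_ge_atTop (2 * (l + 1) / c),
    h2.eventually_ge_atTop (2 * (l + 1) / c)] with n hn1 hn2
  rw [div_le_iff₀ hc] at hn1 hn2
  calc _ ≤ Real.exp l ^ n.1 * Real.exp l ^ n.2 * Real.exp (-(c * (n.1 * n.2))) := by
        gcongr
        exacts [hl.1, hl.2]
    _ = Real.exp (n.1 * l + n.2 * l + -(c * (n.1 * n.2))) := by
        rw [← Real.exp_nat_mul, ← Real.exp_nat_mul, ← Real.exp_add, ← Real.exp_add]
    _ ≤ Real.exp (-n.1) := by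
        refine Real.exp_le_exp.2 ?_
        have := Nat.cast_nonneg (α := ℝ) n.1
        have := Nat.cast_nonneg (α := ℝ) n.2
        nlinarith

/-- Hoeffding's inequality for a double array. -/
theorem measureReal_le_sum_mul_le {Ω : Type*} [MeasurableSpace Ω] (P : Measure Ω)
    [IsProbabilityMeasure P] {N J : ℕ} {Z : Fin N → Fin J → Ω → ℝ}
    (hmeas : ∀ i j, Measurable (Z i j))
    (hind : iIndepFun (fun (q : Fin N × Fin J) => Z q.1 q.2) P)
    (hbd : ∀ i j ω, |Z i j ω| ≤ 1) (hint : ∀ i j, ∫ ω, Z i j ω ∂P = 0)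
    {B : ℝ} (hB : 0 < B) {c : Fin N → Fin J → ℝ} (hc : ∀ i j, |c i j| ≤ B) {t : ℝ} (ht : 0 ≤ t) :
    P.real {ω | t * (N * J) ≤ ∑ i, ∑ j, Z i j ω * c i j} ≤
      Real.exp (-(t ^ 2 / (2 * B ^ 2) * (N * J))) := by
  -- Hoeffding's lemma on [-B, B]: the variance proxy is B².
  have hsub : ∀ q ∈ (Finset.univ : Finset (Fin N × Fin J)),
      HasSubgaussianMGF (fun ω => Z q.1 q.2 ω * c q.1 q.2) ((‖B - -B‖₊ / 2) ^ 2) P := by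
    intro q _
    refine hasSubgaussianMGF_of_mem_Icc_of_integral_eq_zero
      ((hmeas _ _).mul_const _).aemeasurable (ae_of_all _ fun ω => abs_le.1 ?_) ?_
    · rw [abs_mul]
      exact (mul_le_mul (hbd _ _ ω) (hc _ _) (abs_nonneg _) zero_le_one).trans_eq (one_mul B)
    · rw [integral_mul_const, hint, zero_mul]
  have hind' : iIndepFun (fun (q : Fin N × Fin J) ω => Z q.1 q.2 ω * c q.1 q.2) P :=
    hind.comp (fun q z => z * c q.1 q.2) fun q => measurable_id.mul_const _
  have h := HasSubgaussianMGF.measure_sum_ge_le_of_iIndepFun hind' hsub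
    (by positivity : 0 ≤ t * (N * J))
  simp only [Fintype.sum_prod_type] at h
  refine h.trans_eq (congrArg _ ?_)
  have hB' : ‖B + B‖ = B + B := Real.norm_of_nonneg (by positivity)
  simp only [Finset.sum_const, Finset.card_univ, Fintype.card_fin, nsmul_eq_mul,
    NNReal.coe_mul, NNReal.coe_pow, NNReal.coe_div, coe_nnnorm, sub_neg_eq_add, hB',
    NNReal.coe_natCast, NNReal.coe_ofNat]
  rcases N.eq_zero_or_pos with rfl | hN
  · simp
  rcases J.eq_zero_or_pos with rfl | hJ
  · simp
  field_simp
  ring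

/-- A uniform law of large numbers for double arrays: linear functionals of independent centered
bounded noise, whose coefficients depend continuously on row and column parameters in compact
sets, are negligible uniformly in the parameters. -/
theorem tendsto_measure_exists_le_sum {α β : Type*} [PseudoMetricSpace α] [PseudoMetricSpace β]
    {X : Set α} {Y : Set β} (hX : IsCompact X) (hY : IsCompact Y) {φ : α → β → ℝ}
    (hφ : ContinuousOn (fun z : α × β => φ z.1 z.2) (X ×ˢ Y))
    (Ω : ℕ → ℕ → Type*) [∀ N J, MeasurableSpace (Ω N J)]
    (P : ∀ N J, Measure (Ω N J)) [∀ N J, IsProbabilityMeasure (P N J)]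
    (Z : ∀ N J, Fin N → Fin J → Ω N J → ℝ)
    (hZ : ∀ᶠ n : ℕ × ℕ in atTop, (∀ i j, Measurable (Z n.1 n.2 i j)) ∧
      iIndepFun (fun (q : Fin n.1 × Fin n.2) => Z n.1 n.2 q.1 q.2) (P n.1 n.2) ∧
      (∀ i j ω, |Z n.1 n.2 i j ω| ≤ 1) ∧ ∀ i j, ∫ ω, Z n.1 n.2 i j ω ∂(P n.1 n.2) = 0)
    {ε : ℝ} (hε : 0 < ε) :
    Tendsto (fun n : ℕ × ℕ => P n.1 n.2 {ω | ∃ (x : Fin n.1 → α) (y : Fin n.2 → β),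
      (∀ i, x i ∈ X) ∧ (∀ j, y j ∈ Y) ∧
        ε * (n.1 * n.2) ≤ ∑ i, ∑ j, Z n.1 n.2 i j ω * φ (x i) (y j)}) atTop (𝓝 0) := by
  obtain ⟨S, T, r, s, hSX, hTY, hr, hs, happ⟩ := hX.exists_finset_grid hY hφ (half_pos hε)
  obtain ⟨B, hB0, hB⟩ : ∃ B : ℝ, 0 < B ∧ ∀ x ∈ X, ∀ y ∈ Y, |φ x y| ≤ B := by
    obtain ⟨B, hB⟩ := (hX.prod hY).exists_bound_of_continuousOn hφ
    exact ⟨max B 1, by positivity, fun x hx y hy => (hB (x, y) ⟨hx, hy⟩).trans (le_max_left _ _)⟩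
  set c := (ε / 2) ^ 2 / (2 * B ^ 2) with hc
  have hlim := tendsto_pow_mul_pow_mul_exp_neg S.card T.card (by positivity : 0 < c)
  have hlim' := ENNReal.tendsto_ofReal hlim
  rw [ENNReal.ofReal_zero] at hlim'
  refine tendsto_of_tendsto_of_tendsto_of_le_of_le' tendsto_const_nhds hlim'
    (Eventually.of_forall fun _ => zero_le) ?_
  filter_upwards [hZ] with n ⟨hmeas, hind, hbd, hint⟩
  -- `I` consists of the labelings of rows and columns by grid points. Since the noise is at most 1
  -- in absolute value, rounding to the grid costs at most `ε / 2` per entry.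
  let I := Fintype.piFinset (fun _ : Fin n.1 => S) ×ˢ Fintype.piFinset (fun _ : Fin n.2 => T)
  let E : (Fin n.1 → α) × (Fin n.2 → β) → Set (Ω n.1 n.2) := fun a =>
    {ω | ε / 2 * (n.1 * n.2) ≤ ∑ i, ∑ j, Z n.1 n.2 i j ω * φ (a.1 i) (a.2 j)}
  have hE : ∀ a ∈ I, P n.1 n.2 (E a) ≤ ENNReal.ofReal (Real.exp (-(c * (n.1 * n.2)))) := by
    intro a ha
    simp only [I, Finset.mem_product, Fintype.mem_piFinset] at ha
    rw [← ofReal_measureReal]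
    exact ENNReal.ofReal_le_ofReal (measureReal_le_sum_mul_le _ hmeas hind hbd hint hB0
      (fun i j => hB _ (hSX (ha.1 i)) _ (hTY (ha.2 j))) (half_pos hε).le)
  calc _ ≤ P n.1 n.2 (⋃ a ∈ I, E a) := by
        refine measure_mono fun ω ⟨x, y, hx, hy, h⟩ => ?_
        refine Set.mem_iUnion₂.2 ⟨(fun i => r (x i), fun j => s (y j)), ?_, ?_⟩
        · simp only [I, Finset.mem_product, Fintype.mem_piFinset]
          exact ⟨fun i => hr _ (hx i), fun j => hs _ (hy j)⟩
        · have h1 : ∑ i, ∑ j, Z n.1 n.2 i j ω * φ (x i) (y j) ≤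
              ∑ i, ∑ j, (Z n.1 n.2 i j ω * φ (r (x i)) (s (y j)) + ε / 2) := by
            refine Finset.sum_le_sum fun i _ => Finset.sum_le_sum fun j _ => ?_
            rw [← sub_le_iff_le_add', ← mul_sub]
            refine (le_abs_self _).trans ?_
            rw [abs_mul]
            exact (mul_le_mul (hbd i j ω) (happ _ (hx i) _ (hy j)) (abs_nonneg _)
              zero_le_one).trans_eq (one_mul _)
          simp only [Finset.sum_add_distrib, Finset.sum_const, Finset.card_univ, Fintype.card_fin,
            nsmul_eq_mul] at h1
          change ε / 2 * (n.1 * n.2) ≤ _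
          dsimp only
          linarith
    _ ≤ ∑ a ∈ I, P n.1 n.2 (E a) := measure_biUnion_finset_le _ _
    _ ≤ ∑ _a ∈ I, ENNReal.ofReal (Real.exp (-(c * (n.1 * n.2)))) := Finset.sum_le_sum hE
    _ = _ := by
        rw [Finset.sum_const, nsmul_eq_mul, Finset.card_product, Fintype.card_piFinset_const,
          Fintype.card_piFinset_const, ENNReal.ofReal_mul (by positivity)]
        simp [ENNReal.ofReal_mul, ENNReal.ofReal_pow]

/-! ### Noise of the factor model and consistency -/

/-- The noise of a factor model is independent, centered and bounded. -/
theorem IsFactorModel.noise {N J K : ℕ} {Ω : Type*} [MeasurableSpace Ω] {P : Measure Ω}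
    [IsProbabilityMeasure P] {f : ℝ → ℝ} {p : FactorParams N J K} {Y : Fin N → Fin J → Ω → Bool}
    (h : IsFactorModel P f p Y) :
    (∀ i j, Measurable fun ω => (if Y i j ω then (1 : ℝ) else 0) - f (p.predictor i j)) ∧
      iIndepFun (fun (q : Fin N × Fin J) ω =>
        (if Y q.1 q.2 ω then (1 : ℝ) else 0) - f (p.predictor q.1 q.2)) P ∧
      (∀ i j ω, |(if Y i j ω then (1 : ℝ) else 0) - f (p.predictor i j)| ≤ 1) ∧
      ∀ i j, ∫ ω, ((if Y i j ω then (1 : ℝ) else 0) - f (p.predictor i j)) ∂P = 0 := by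
  obtain ⟨hm, hi, hp⟩ := h
  have hm' : ∀ i j, MeasurableSet {ω | Y i j ω = true} := fun i j =>
    hm i j (measurableSet_singleton true)
  refine ⟨fun i j => (Measurable.ite (hm' i j) measurable_const measurable_const).sub_const _,
    hi.comp (fun q b => (if b then (1 : ℝ) else 0) - f (p.predictor q.1 q.2))
      fun q => measurable_of_finite _, fun i j ω => ?_, fun i j => ?_⟩
  -- These values of `f` are probabilities by the model, so no norm constraint is needed.
  · have h0 : 0 ≤ f (p.predictor i j) := hp i j ▸ measureReal_nonneg
    have h1 : f (p.predictor i j) ≤ 1 := hp i j ▸ measureReal_le_one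
    rw [abs_le]
    split_ifs <;> constructor <;> linarith
  · have h1 : (fun ω => if Y i j ω then (1 : ℝ) else 0) =
        Set.indicator {ω | Y i j ω = true} 1 := by
      ext ω
      simp [Set.indicator_apply]
    have h2 : Integrable (Set.indicator {ω | Y i j ω = true} (1 : Ω → ℝ)) P :=
      (integrable_const 1).indicator (hm' i j)
    rw [integral_sub (h1 ▸ h2) (integrable_const _), h1, integral_indicator_one (hm' i j), hp]
    simp

theorem FactorParams.continuousOn_logOdds_sub {K : ℕ} {f : ℝ → ℝ} {C : ℝ} (hC : 0 < C)
    (hf : RegularLink f C) :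
    ContinuousOn (fun z : ((Fin K → ℝ) × (Fin K → ℝ)) ×
        (((Fin K → ℝ) × ℝ) × ((Fin K → ℝ) × ℝ)) =>
      logOdds f (linearPredictor z.1.1 z.2.1) - logOdds f (linearPredictor z.1.2 z.2.2))
      ((personBall K C ×ˢ personBall K C) ×ˢ (itemBall K C ×ˢ itemBall K C)) := by
  unfold linearPredictor
  refine (hf.continuousOn_logOdds.comp (by fun_prop) fun z hz => ?_).sub
    (hf.continuousOn_logOdds.comp (by fun_prop) fun z hz => ?_)
  · exact abs_linearPredictor_le hC hz.1.1 hz.2.1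
  · exact abs_linearPredictor_le hC hz.1.2 hz.2.2

theorem theorem2
    (K : ℕ) (hK : 1 ≤ K) (C : ℝ) (hC : 0 < C) (f : ℝ → ℝ)
    -- the probability spaces and the responses, for each sample size `(N, J)`
    (Ω : ℕ → ℕ → Type*) [∀ N J, MeasurableSpace (Ω N J)]
    (P : ∀ N J, Measure (Ω N J)) [∀ N J, IsProbabilityMeasure (P N J)]
    (Y : ∀ N J, Fin N → Fin J → Ω N J → Bool)
    -- the true parameters, the estimator and its standardized version
    (star : ∀ N J, FactorParams N J K)
    (hat tilde : ∀ N J, Ω N J → FactorParams N J K)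
    (hmodel : ∀ᶠ n : ℕ × ℕ in atTop,
      IsFactorModel (P n.1 n.2) f (star n.1 n.2) (Y n.1 n.2))
    (hhat : ∀ᶠ n : ℕ × ℕ in atTop, ∀ ω,
      (hat n.1 n.2 ω).IsCJMLE f C (fun i j => Y n.1 n.2 i j ω))
    (htilde : ∀ᶠ n : ℕ × ℕ in atTop, ∀ ω,
      (hat n.1 n.2 ω).IsStandardization (tilde n.1 n.2 ω))
    (hA1 : ∀ᶠ n : ℕ × ℕ in atTop, (star n.1 n.2).Feasible C)
    (hA2 : RegularLink f C)
    (hA3 : ∀ᶠ n : ℕ × ℕ in atTop, (star n.1 n.2).Standardized)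
    (hA4 : ∃ C₃ : ℝ, 0 < C₃ ∧ ∀ᶠ n : ℕ × ℕ in atTop,
      C₃ * Real.sqrt (n.2 : ℝ) ≤ smallestSingularValue (star n.1 n.2).A) :
    ∀ ε : ℝ, 0 < ε →
      Tendsto
        (fun n : ℕ × ℕ => P n.1 n.2
          {ω | ε ≤ rotationLoss (star n.1 n.2).A (tilde n.1 n.2 ω).A})
        atTop (𝓝 0) := by
  intro ε hε
  obtain ⟨C₃, hC₃, hA4⟩ := hA4
  obtain ⟨δ, hδ, hloss⟩ := FactorParams.exists_rotationLoss_lt hK hC hC₃ hε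
  obtain ⟨c, hc, hbasic⟩ := FactorParams.exists_mul_sum_sq_le hC hA2
  have hX := FactorParams.isCompact_personBall K C
  have hI := FactorParams.isCompact_itemBall K C
  have hlim := tendsto_measure_exists_le_sum (hX.prod hX) (hI.prod hI)
    (φ := fun x y => logOdds f (FactorParams.linearPredictor x.1 y.1) -
      logOdds f (FactorParams.linearPredictor x.2 y.2))
    (FactorParams.continuousOn_logOdds_sub hC hA2) Ω P
    (fun N J i j ω => (if Y N J i j ω then (1 : ℝ) else 0) - f ((star N J).predictor i j))
    (hmodel.mono fun n hn => hn.noise) (mul_pos hc hδ)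
  -- A large loss forces a large noise functional for some parameters, so monotonicity of the
  -- measure suffices, without measurability of the estimator.
  refine tendsto_of_tendsto_of_tendsto_of_le_of_le' tendsto_const_nhds hlim
    (Eventually.of_forall fun _ => zero_le) ?_
  filter_upwards [hhat, htilde, hA1, hA3, hA4, eventually_ge_atTop ((1, 1) : ℕ × ℕ)]
    with n hhat htilde hA1 hA3 hA4 hn
  refine measure_mono fun ω hω => ?_
  -- Row and column points pair estimate with truth. The estimate is `hat`, which obeys the
  -- constraints; `tilde` enters only through its equal predictors.
  refine ⟨fun i => ((hat n.1 n.2 ω).Θ i, (star n.1 n.2).Θ i),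
    fun j => (((hat n.1 n.2 ω).A j, (hat n.1 n.2 ω).d j),
      ((star n.1 n.2).A j, (star n.1 n.2).d j)),
    fun i => ⟨(hhat ω).1.1 i, hA1.1 i⟩, fun j => ⟨(hhat ω).1.2 j, hA1.2 j⟩, ?_⟩
  refine le_trans ?_ (hbasic _ _ _ _ _ hA1 (hhat ω))
  by_contra! hlt
  refine absurd (hloss n.1 n.2 hn.1 hn.2 _ _ hA3 (htilde ω).1 hA1 hA4 ?_) (not_lt.2 hω)
  simp only [(htilde ω).2]
  rw [mul_assoc] at hlt
  exact (lt_of_mul_lt_mul_left hlt hc.le).le
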